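/- Let $n\ge 1$, $\mathbb T^n=\mathbb R^n/\mathbb Z^n$ with Lebesgue measure of total mass one, $P\in\mathbb R^n$, $s_L>0$, $d>0$. Let $V\in L^\infty(\mathbb T^n;\mathbb R^n)$ be a bounded periodic vector field with $\int_{\mathbb T^n}V\,dx=0$ and $\operatorname{div}V=0$ in the sense of distributions (for instance a smooth one). Let $H^1_{per}$ be the space of mean-zero functions in $H^1(\mathbb T^n)$, with the $H^1$ norm, and let $D$ denote the weak gradient. (i) For every $u\in H^1_{per}$ there is a unique weak solution $v\in H^1_{per}$ of $$-d\,s_L\Delta v+V\cdot Dv = s_L\int_{\mathbb T^n}|P+Du|\,dx-s_L|P+Du|-V\cdot P\quad\text{on }\mathbb T^n .$$ Hence every $u^{(0)}\in H^1_{per}$ determines a unique sequence $(u^{(k)})_{k\ge 0}$ in $H^1_{per}$ with $$-d\,s_L\Delta u^{(k+1)}+V\cdot Du^{(k+1)}=H^{(k)}-s_L|P+Du^{(k)}|-V\cdot P,\qquad H^{(k)}=s_L\int_{\mathbb T^n}|P+Du^{(k)}|\,dx .$$ (ii) Suppose $d>\sqrt n/\pi$. Then for every such sequence $Du^{(k)}$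 is contracting in $L^2$: for all $k\ge 0$, $$\|Du^{(k+2)}-Du^{(k+1)}\|_{L^2(\mathbb T^n)}\le\frac{\sqrt n}{\pi d}\,\|Du^{(k+1)}-Du^{(k)}\|_{L^2(\mathbb T^n)},\qquad \frac{\sqrt n}{\pi d}<1 .$$ Moreover there is exactly one pair $(\bar u,\bar H)\in H^1_{per}\times\mathbb R$ that solves weakly the corrector problem of the viscous G-equation $$-d\,s_L\Delta\bar u+V\cdot(P+D\bar u)+s_L|P+D\bar u|=\bar H\quad\text{on }\mathbb T^n$$ (the number $\bar H$ is the turbulent flame speed $s_T$ of the viscous G-equation in direction $P$); it satisfies $\bar H=s_L\int_{\mathbb T^n}|P+D\bar u|\,dx$; and for every starting point $u^{(0)}\in H^1_{per}$ the sequence $u^{(k)}$ converges to $\bar u$ in $H^1_{per}$ and $H^{(k)}\to\bar H$. Here $u\in H^1_{per}$ is a weak solution of $-c\Delta u+V\cdot Du=f$ if $c\int Du\cdot D\varphi\,dx+\int (V\cdot Du)\,\varphi\,dx=\int f\varphi\,dx$ for all $\varphi\in C^\infty(\mathbb T^n)$. -/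

import Mathlib

open MeasureTheory Filter Topology
open scoped ContDiff ENNReal InnerProductSpace

noncomputable section

namespace ViscousG

/-- The flat torus `ℝⁿ / ℤⁿ`. -/
abbrev Torus (n : ℕ) : Type := UnitAddTorus (Fin n)

/-- Euclidean space `ℝⁿ`. -/
abbrev Vec (n : ℕ) : Type := EuclideanSpace ℝ (Fin n)

/-- Lebesgue measure on the torus, i.e. Haar measure of total mass one. -/
abbrev torusMeasure (n : ℕ) : Measure (Torus n) :=
  Measure.pi fun _ : Fin n => (AddCircle.haarAddCircle : Measure UnitAddCircle)

/-- The covering map `ℝⁿ → ℝⁿ / ℤⁿ`. -/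
def toTorus {n : ℕ} (x : Fin n → ℝ) : Torus n := fun i => (x i : UnitAddCircle)

/-- Smooth functions on the torus: those whose lift to `ℝⁿ` is `C^∞`. -/
def IsSmooth {n : ℕ} (φ : Torus n → ℝ) : Prop :=
  ContDiff ℝ ∞ fun x : Fin n → ℝ => φ (toTorus x)

/-- The partial derivative in the `i`-th coordinate direction of a function on the torus. -/
def partialDeriv {n : ℕ} (i : Fin n) (φ : Torus n → ℝ) (x : Torus n) : ℝ :=
  deriv (fun t : ℝ => φ (x + Pi.single i (t : UnitAddCircle))) 0

/-- The classical gradient of a function on the torus. -/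
def grad {n : ℕ} (φ : Torus n → ℝ) (x : Torus n) : Vec n :=
  WithLp.toLp 2 fun i => partialDeriv i φ x

/-- `g` is the weak gradient of `u`: `∫ u ∂ᵢφ = - ∫ gᵢ φ` for all smooth `φ` and all `i`. -/
def HasWeakGradient {n : ℕ} (u : Torus n → ℝ) (g : Torus n → Vec n) : Prop :=
  ∀ φ : Torus n → ℝ, IsSmooth φ → ∀ i : Fin n,
    ∫ x, u x * partialDeriv i φ x ∂torusMeasure n = -∫ x, g x i * φ x ∂torusMeasure n

lemma isOpenQuotientMap_toTorus (n : ℕ) : IsOpenQuotientMap (toTorus (n := n)) := by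
  have h : IsOpenQuotientMap (fun t : ℝ => (t : UnitAddCircle)) :=
    QuotientAddGroup.isOpenQuotientMap_mk
  exact IsOpenQuotientMap.piMap (fun _ : Fin n => h)

lemma IsSmooth.continuous {n : ℕ} {φ : Torus n → ℝ} (h : IsSmooth φ) : Continuous φ :=
  (isOpenQuotientMap_toTorus n).continuous_comp_iff.1 (ContDiff.continuous h)

lemma toTorus_add_single {n : ℕ} (x : Fin n → ℝ) (i : Fin n) (t : ℝ) :
    toTorus x + Pi.single i (t : UnitAddCircle) = toTorus (x + t • Pi.single i (1 : ℝ)) := by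
  funext j
  by_cases hj : j = i
  · subst hj
    simp [toTorus]
  · simp [toTorus, hj]

/-- On the lift, `partialDeriv` is the usual partial derivative. -/
lemma IsSmooth.partialDeriv_toTorus {n : ℕ} {φ : Torus n → ℝ} (h : IsSmooth φ) (i : Fin n)
    (x : Fin n → ℝ) :
    partialDeriv i φ (toTorus x) =
      fderiv ℝ (fun y : Fin n → ℝ => φ (toTorus y)) x (Pi.single i (1 : ℝ)) := by
  have hd : DifferentiableAt ℝ (fun y : Fin n → ℝ => φ (toTorus y)) x :=
    (ContDiff.differentiable h (by simp)).differentiableAt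
  simp only [partialDeriv, toTorus_add_single]
  exact hd.lineDeriv_eq_fderiv

lemma IsSmooth.continuous_partialDeriv {n : ℕ} {φ : Torus n → ℝ} (h : IsSmooth φ) (i : Fin n) :
    Continuous (partialDeriv i φ) := by
  refine (isOpenQuotientMap_toTorus n).continuous_comp_iff.1 ?_
  have : partialDeriv i φ ∘ toTorus = fun x =>
      fderiv ℝ (fun y : Fin n → ℝ => φ (toTorus y)) x (Pi.single i (1 : ℝ)) :=
    funext fun x => h.partialDeriv_toTorus i x
  rw [this]
  exact (ContDiff.continuous_fderiv h (by simp)).clm_apply continuous_const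

lemma integrable_mul_of_continuous {n : ℕ} {f ψ : Torus n → ℝ}
    (hf : MemLp f 2 (torusMeasure n)) (hψ : Continuous ψ) :
    Integrable (fun x => f x * ψ x) (torusMeasure n) := by
  have hψ2 : MemLp ψ 2 (torusMeasure n) :=
    MemLp.of_bound hψ.aestronglyMeasurable ‖(⟨ψ, hψ⟩ : C(Torus n, ℝ))‖
      (Eventually.of_forall fun x => (⟨ψ, hψ⟩ : C(Torus n, ℝ)).norm_coe_le_norm x)
  exact hf.integrable_mul hψ2

lemma memLp_coord {n : ℕ} {g : Torus n → Vec n} (hg : MemLp g 2 (torusMeasure n)) (i : Fin n) :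
    MemLp (fun x => g x i) 2 (torusMeasure n) :=
  (EuclideanSpace.proj (𝕜 := ℝ) i).comp_memLp' hg

/-- The pairs `(u, g) ∈ L²(𝕋ⁿ) × L²(𝕋ⁿ; ℝⁿ)`, with the norm `(‖u‖² + ‖g‖²)^(1/2)`. -/
abbrev L2Pair (n : ℕ) : Type :=
  WithLp 2 (Lp ℝ 2 (torusMeasure n) × Lp (Vec n) 2 (torusMeasure n))

/-- The space `H¹_per` of mean-zero functions in `H¹(𝕋ⁿ)` with the usual `H¹` norm, realised as the
space of pairs `(u, Du)` where `u ∈ L²` has mean zero and `Du ∈ L²` is its weak gradient. -/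
def H1per (n : ℕ) : Submodule ℝ (L2Pair n) where
  carrier := {w | HasWeakGradient w.fst w.snd ∧ ∫ x, w.fst x ∂torusMeasure n = 0}
  zero_mem' := by
    have h1 : ((0 : L2Pair n).fst : Torus n → ℝ) =ᵐ[torusMeasure n] 0 := Lp.coeFn_zero _ _ _
    have h2 : ((0 : L2Pair n).snd : Torus n → Vec n) =ᵐ[torusMeasure n] 0 := Lp.coeFn_zero _ _ _
    refine ⟨fun φ _ i => ?_, ?_⟩
    · rw [integral_congr_ae (g := fun _ => (0 : ℝ)) (by filter_upwards [h1] with x hx; rw [hx]; simp),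
        integral_congr_ae (f := fun x => (0 : L2Pair n).snd x i * φ x) (g := fun _ => (0 : ℝ))
          (by filter_upwards [h2] with x hx; rw [hx]; simp)]
      simp
    · rw [integral_congr_ae h1]
      simp
  add_mem' := by
    rintro a b ⟨ha, ha0⟩ ⟨hb, hb0⟩
    have h1 : ((a + b).fst : Torus n → ℝ) =ᵐ[torusMeasure n] a.fst + b.fst := Lp.coeFn_add _ _
    have h2 : ((a + b).snd : Torus n → Vec n) =ᵐ[torusMeasure n] a.snd + b.snd :=
      Lp.coeFn_add _ _
    refine ⟨fun φ hφ i => ?_, ?_⟩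
    · rw [integral_congr_ae (g := fun x => a.fst x * partialDeriv i φ x +
          b.fst x * partialDeriv i φ x) (by filter_upwards [h1] with x hx; rw [hx]; simp [add_mul]),
        integral_congr_ae (f := fun x => (a + b).snd x i * φ x)
          (g := fun x => a.snd x i * φ x + b.snd x i * φ x)
          (by filter_upwards [h2] with x hx; rw [hx]; simp [add_mul]),
        integral_add (integrable_mul_of_continuous (Lp.memLp _) (hφ.continuous_partialDeriv i))
          (integrable_mul_of_continuous (Lp.memLp _) (hφ.continuous_partialDeriv i)),
        integral_add (integrable_mul_of_continuous (memLp_coord (Lp.memLp _) i) hφ.continuous)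
          (integrable_mul_of_continuous (memLp_coord (Lp.memLp _) i) hφ.continuous),
        ha φ hφ i, hb φ hφ i]
      ring
    · rw [integral_congr_ae h1]
      simp only [Pi.add_apply]
      rw [integral_add ((Lp.memLp a.fst).integrable (by norm_num))
        ((Lp.memLp b.fst).integrable (by norm_num)), ha0, hb0, add_zero]
  smul_mem' := by
    rintro c a ⟨ha, ha0⟩
    have h1 : ((c • a).fst : Torus n → ℝ) =ᵐ[torusMeasure n] c • ⇑a.fst := Lp.coeFn_smul _ _
    have h2 : ((c • a).snd : Torus n → Vec n) =ᵐ[torusMeasure n] c • ⇑a.snd := Lp.coeFn_smul _ _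
    refine ⟨fun φ hφ i => ?_, ?_⟩
    · rw [integral_congr_ae (g := fun x => c * (a.fst x * partialDeriv i φ x))
          (by filter_upwards [h1] with x hx; rw [hx]; simp [mul_assoc]),
        integral_congr_ae (f := fun x => (c • a).snd x i * φ x)
          (g := fun x => c * (a.snd x i * φ x))
          (by filter_upwards [h2] with x hx; rw [hx]; simp [mul_assoc]),
        integral_const_mul, integral_const_mul, ha φ hφ i]
      ring
    · rw [integral_congr_ae h1]
      simp only [Pi.smul_apply, smul_eq_mul]
      rw [integral_const_mul, ha0, mul_zero]

/-- The weak gradient `Du ∈ L²(𝕋ⁿ; ℝⁿ)` of `u ∈ H¹_per`. -/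
def D {n : ℕ} (u : H1per n) : Lp (Vec n) 2 (torusMeasure n) := (u : L2Pair n).snd

/-- `V` is divergence free in the sense of distributions on the torus. -/
def IsDivFree {n : ℕ} (V : Torus n → Vec n) : Prop :=
  ∀ φ : Torus n → ℝ, IsSmooth φ → ∫ x, ⟪V x, grad φ x⟫_ℝ ∂torusMeasure n = 0

/-- `u` is a weak solution of `-c Δu + V · Du = f` on the torus. -/
def IsWeakSolution {n : ℕ} (c : ℝ) (V : Torus n → Vec n) (f : Torus n → ℝ) (u : H1per n) : Prop :=
  ∀ φ : Torus n → ℝ, IsSmooth φ →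
    c * ∫ x, ⟪D u x, grad φ x⟫_ℝ ∂torusMeasure n + ∫ x, ⟪V x, D u x⟫_ℝ * φ x ∂torusMeasure n =
      ∫ x, f x * φ x ∂torusMeasure n

/-- The number `s_L ∫ |P + Du|`. -/
def meanBurning {n : ℕ} (sL : ℝ) (P : Vec n) (u : H1per n) : ℝ :=
  sL * ∫ x, ‖P + D u x‖ ∂torusMeasure n

/-- One step of the iteration: `v` is a weak solution of
`-d s_L Δv + V · Dv = s_L ∫ |P + Du| - s_L |P + Du| - V · P`. -/
def IsIterationStep {n : ℕ} (d sL : ℝ) (V : Torus n → Vec n) (P : Vec n) (u v : H1per n) : Prop :=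
  IsWeakSolution (d * sL) V
    (fun x => meanBurning sL P u - sL * ‖P + D u x‖ - ⟪V x, P⟫_ℝ) v

/-- `(u, H)` solves weakly the corrector problem of the viscous G-equation,
`-d s_L Δu + V · (P + Du) + s_L |P + Du| = H`. The number `H` (the effective Hamiltonian) is the
turbulent flame speed `s_T` in direction `P`. -/
def IsCorrector {n : ℕ} (d sL : ℝ) (V : Torus n → Vec n) (P : Vec n) (u : H1per n) (H : ℝ) :
    Prop :=
  IsWeakSolution (d * sL) V (fun x => H - sL * ‖P + D u x‖ - ⟪V x, P⟫_ℝ) u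

end ViscousG

end

/-! Each step of the iteration is a linear problem for the form `d s_L ∫ Dv·Dw + ∫ (V·Dv) w`.
Because `V` is divergence free, the drift part is antisymmetric, so the form on the diagonal is `d
s_L ‖Dv‖²`; Poincaré's inequality makes it coercive and Lax–Milgram solves the step. Mean-zero test
functions suffice because the right-hand side has mean zero; conversely, testing with the constant 1
forces `H = s_L ∫ |P + Du|`. A corrector is therefore the same as a fixed point of the step map.

For two steps, testing the difference of the equations with `w = v₁ - v₂` removes the drift, the
constants and `V·P`. Since `|P + ·|` is 1-Lipschitz, `d s_L ‖Dw‖² ≤ s_L ‖Du₁ - Du₂‖ ‖w‖`, and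
Poincaré with constant `1/(2π)` gives the contraction factor `1/(2πd) ≤ √n/(πd)`
(`norm_D_sub_le_of_isIterationStep`). Banach's argument does the rest.

Poincaré (`norm_fn_le`) and the density of smooth functions (`dense_span_smoothSet`) both come from
Fourier series: a weak gradient tested against trigonometric modes has coefficients determined by
those of the function. -/

noncomputable section

namespace ViscousG

variable {n : ℕ}


/-! ### Real Fourier modes and Parseval's identity -/

/-- The real part of the Fourier monomial with frequency `k`. -/
def cosMode (k : Fin n → ℤ) (x : Torus n) : ℝ := (UnitAddTorus.mFourier k x).re

/-- The imaginary part of the Fourier monomial with frequency `k`. -/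
def sinMode (k : Fin n → ℤ) (x : Torus n) : ℝ := (UnitAddTorus.mFourier k x).im

lemma mFourier_toTorus (k : Fin n → ℤ) (x : Fin n → ℝ) :
    UnitAddTorus.mFourier k (toTorus x) =
      Complex.exp (((2 * Real.pi * ∑ i, k i * x i : ℝ) : ℂ) * Complex.I) := by
  simp only [UnitAddTorus.mFourier, ContinuousMap.coe_mk, toTorus, fourier_coe_apply]
  rw [← Complex.exp_sum]
  congr 1
  push_cast
  rw [Finset.mul_sum, Finset.sum_mul]
  refine Finset.sum_congr rfl fun i _ => ?_
  ring

lemma cosMode_toTorus (k : Fin n → ℤ) (x : Fin n → ℝ) :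
    cosMode k (toTorus x) = Real.cos (2 * Real.pi * ∑ i, k i * x i) := by
  rw [cosMode, mFourier_toTorus, Complex.exp_ofReal_mul_I_re]

lemma sinMode_toTorus (k : Fin n → ℤ) (x : Fin n → ℝ) :
    sinMode k (toTorus x) = Real.sin (2 * Real.pi * ∑ i, k i * x i) := by
  rw [sinMode, mFourier_toTorus, Complex.exp_ofReal_mul_I_im]

lemma isSmooth_cosMode (k : Fin n → ℤ) : IsSmooth (cosMode k) := by
  simp only [IsSmooth, cosMode_toTorus]
  fun_prop

lemma isSmooth_sinMode (k : Fin n → ℤ) : IsSmooth (sinMode k) := by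
  simp only [IsSmooth, sinMode_toTorus]
  fun_prop

lemma hasDerivAt_phase (k : Fin n → ℤ) (i : Fin n) (y : Fin n → ℝ) :
    HasDerivAt (fun t : ℝ => 2 * Real.pi * ∑ j, k j * (y + t • (Pi.single i 1 : Fin n → ℝ)) j)
      (2 * Real.pi * k i) 0 := by
  have h : ∀ t : ℝ, 2 * Real.pi * ∑ j, k j * (y + t • (Pi.single i 1 : Fin n → ℝ)) j =
      2 * Real.pi * ∑ j, k j * y j + t * (2 * Real.pi * k i) := by
    intro t
    simp [mul_add, Finset.sum_add_distrib, Pi.single_apply]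
    ring
  simp only [h]
  simpa using ((hasDerivAt_id (0 : ℝ)).mul_const (2 * Real.pi * k i)).const_add
    (2 * Real.pi * ∑ j, k j * y j)

lemma partialDeriv_cosMode (k : Fin n → ℤ) (i : Fin n) (x : Torus n) :
    partialDeriv i (cosMode k) x = -(2 * Real.pi * k i) * sinMode k x := by
  obtain ⟨y, rfl⟩ := (isOpenQuotientMap_toTorus n).surjective x
  simp only [partialDeriv, toTorus_add_single, cosMode_toTorus, sinMode_toTorus]
  rw [(hasDerivAt_phase k i y).cos.deriv]
  simp
  ring

lemma partialDeriv_sinMode (k : Fin n → ℤ) (i : Fin n) (x : Torus n) :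
    partialDeriv i (sinMode k) x = 2 * Real.pi * k i * cosMode k x := by
  obtain ⟨y, rfl⟩ := (isOpenQuotientMap_toTorus n).surjective x
  simp only [partialDeriv, toTorus_add_single, cosMode_toTorus, sinMode_toTorus]
  rw [(hasDerivAt_phase k i y).sin.deriv]
  simp
  ring

lemma cosMode_zero : cosMode (0 : Fin n → ℤ) = fun _ => 1 := by
  funext x
  simp [cosMode, UnitAddTorus.mFourier_zero]

lemma sinMode_zero : sinMode (0 : Fin n → ℤ) = fun _ => 0 := by
  funext x
  simp [sinMode, UnitAddTorus.mFourier_zero]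

/-- The cosine coefficient of `f` at frequency `k`. -/
def cosCoeff (f : Torus n → ℝ) (k : Fin n → ℤ) : ℝ := ∫ x, f x * cosMode k x ∂torusMeasure n

/-- The sine coefficient of `f` at frequency `k`. -/
def sinCoeff (f : Torus n → ℝ) (k : Fin n → ℤ) : ℝ := ∫ x, f x * sinMode k x ∂torusMeasure n

lemma integral_mFourier_neg_mul {f : Torus n → ℝ} (hf : MemLp f 2 (torusMeasure n))
    (k : Fin n → ℤ) :
    ∫ x, UnitAddTorus.mFourier (-k) x * (f x : ℂ) ∂torusMeasure n =
      ⟨cosCoeff f k, -sinCoeff f k⟩ := by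
  have hc := integrable_mul_of_continuous hf (isSmooth_cosMode k).continuous
  have hs := integrable_mul_of_continuous hf (isSmooth_sinMode k).continuous
  have h : ∀ x, UnitAddTorus.mFourier (-k) x * (f x : ℂ) =
      ((f x * cosMode k x : ℝ) : ℂ) + ((-(f x * sinMode k x) : ℝ) : ℂ) * Complex.I := by
    intro x
    rw [UnitAddTorus.mFourier_neg]
    apply Complex.ext <;> simp [cosMode, sinMode] <;> ring
  simp only [h]
  rw [integral_add hc.ofReal (hs.neg.ofReal.mul_const _), integral_mul_const,
    integral_complex_ofReal, integral_complex_ofReal, integral_neg]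
  apply Complex.ext <;> simp [cosCoeff, sinCoeff]

/-- **Parseval's identity** for real functions on the torus. -/
lemma hasSum_sq_coeff {f : Torus n → ℝ} (hf : MemLp f 2 (torusMeasure n)) :
    HasSum (fun k => cosCoeff f k ^ 2 + sinCoeff f k ^ 2) (∫ x, f x ^ 2 ∂torusMeasure n) := by
  have hF : MemLp (fun x => (f x : ℂ)) 2 (torusMeasure n) := hf.ofReal
  have h1 : HasSum (fun k : Fin n → ℤ =>
        ‖∫ x, UnitAddTorus.mFourier (-k) x • hF.toLp _ x ∂torusMeasure n‖ ^ 2)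
      (∫ x, ‖hF.toLp _ x‖ ^ 2 ∂torusMeasure n) :=
    UnitAddTorus.hasSum_sq_mFourierCoeff (hF.toLp _)
  have hae := hF.coeFn_toLp
  have h2 : ∫ x, ‖hF.toLp _ x‖ ^ 2 ∂torusMeasure n = ∫ x, f x ^ 2 ∂torusMeasure n :=
    integral_congr_ae (by filter_upwards [hae] with x hx; rw [hx]; simp)
  rw [h2] at h1
  refine h1.congr_fun fun k => ?_
  have h3 : ∫ x, UnitAddTorus.mFourier (-k) x • hF.toLp _ x ∂torusMeasure n =
      ∫ x, UnitAddTorus.mFourier (-k) x * (f x : ℂ) ∂torusMeasure n :=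
    integral_congr_ae (by filter_upwards [hae] with x hx; rw [hx]; simp)
  rw [h3, integral_mFourier_neg_mul hf, Complex.sq_norm, Complex.normSq_mk]
  ring

/-- The modes are admissible test functions, and differentiation exchanges cosine and sine. -/
lemma cosCoeff_of_hasWeakGradient {u : Torus n → ℝ} {g : Torus n → Vec n}
    (h : HasWeakGradient u g) (k : Fin n → ℤ) (i : Fin n) :
    cosCoeff (fun x => g x i) k = 2 * Real.pi * k i * sinCoeff u k := by
  have := h _ (isSmooth_cosMode k) i
  simp only [partialDeriv_cosMode] at this
  rw [cosCoeff, sinCoeff, ← integral_const_mul, eq_comm, ← neg_inj, ← this, ← integral_neg]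
  congr 1
  funext x
  ring

lemma sinCoeff_of_hasWeakGradient {u : Torus n → ℝ} {g : Torus n → Vec n}
    (h : HasWeakGradient u g) (k : Fin n → ℤ) (i : Fin n) :
    sinCoeff (fun x => g x i) k = -(2 * Real.pi * k i * cosCoeff u k) := by
  have := h _ (isSmooth_sinMode k) i
  simp only [partialDeriv_sinMode] at this
  rw [cosCoeff, sinCoeff, ← integral_const_mul, eq_comm, ← neg_inj, ← this, neg_neg]
  congr 1
  funext x
  ring


/-! ### Calculus of smooth functions on the torus -/

lemma isSmooth_const (c : ℝ) : IsSmooth (fun _ : Torus n => c) := contDiff_const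

lemma IsSmooth.add {φ ψ : Torus n → ℝ} (hφ : IsSmooth φ) (hψ : IsSmooth ψ) :
    IsSmooth (fun x => φ x + ψ x) := ContDiff.add hφ hψ

lemma IsSmooth.mul {φ ψ : Torus n → ℝ} (hφ : IsSmooth φ) (hψ : IsSmooth ψ) :
    IsSmooth (fun x => φ x * ψ x) := ContDiff.mul hφ hψ

lemma IsSmooth.hasDerivAt {φ : Torus n → ℝ} (hφ : IsSmooth φ) (i : Fin n) (x : Torus n) (t : ℝ) :
    HasDerivAt (fun s : ℝ => φ (x + Pi.single i (s : UnitAddCircle)))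
      (partialDeriv i φ (x + Pi.single i (t : UnitAddCircle))) t := by
  obtain ⟨y, rfl⟩ := (isOpenQuotientMap_toTorus n).surjective x
  simp only [toTorus_add_single]
  rw [hφ.partialDeriv_toTorus]
  have hd : HasFDerivAt (fun z : Fin n → ℝ => φ (toTorus z)) _
      (y + t • (Pi.single i 1 : Fin n → ℝ)) :=
    (ContDiff.differentiable hφ (by simp)).differentiableAt.hasFDerivAt
  have hl : HasDerivAt (fun s : ℝ => y + s • (Pi.single i 1 : Fin n → ℝ))
      (Pi.single i 1 : Fin n → ℝ) t := by
    simpa using ((hasDerivAt_id t).smul_const (Pi.single i 1 : Fin n → ℝ)).const_add y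
  exact hd.comp_hasDerivAt t hl

lemma IsSmooth.hasDerivAt_zero {φ : Torus n → ℝ} (hφ : IsSmooth φ) (i : Fin n) (x : Torus n) :
    HasDerivAt (fun s : ℝ => φ (x + Pi.single i (s : UnitAddCircle))) (partialDeriv i φ x) 0 := by
  simpa using hφ.hasDerivAt i x 0

lemma partialDeriv_const (c : ℝ) (i : Fin n) (x : Torus n) :
    partialDeriv i (fun _ => c) x = 0 := by
  simp [partialDeriv]

lemma partialDeriv_add {φ ψ : Torus n → ℝ} (hφ : IsSmooth φ) (hψ : IsSmooth ψ) (i : Fin n)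
    (x : Torus n) :
    partialDeriv i (fun x => φ x + ψ x) x = partialDeriv i φ x + partialDeriv i ψ x :=
  ((hφ.hasDerivAt_zero i x).add (hψ.hasDerivAt_zero i x)).deriv

lemma partialDeriv_mul {φ ψ : Torus n → ℝ} (hφ : IsSmooth φ) (hψ : IsSmooth ψ) (i : Fin n)
    (x : Torus n) :
    partialDeriv i (fun x => φ x * ψ x) x =
      partialDeriv i φ x * ψ x + φ x * partialDeriv i ψ x := by
  have h := ((hφ.hasDerivAt_zero i x).mul (hψ.hasDerivAt_zero i x)).deriv
  simp only [QuotientAddGroup.mk_zero, Pi.single_zero, add_zero] at h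
  exact h

lemma grad_const (c : ℝ) (x : Torus n) : grad (fun _ => c) x = 0 := by
  ext i
  simp [grad, partialDeriv_const]

lemma grad_add {φ ψ : Torus n → ℝ} (hφ : IsSmooth φ) (hψ : IsSmooth ψ) (x : Torus n) :
    grad (fun x => φ x + ψ x) x = grad φ x + grad ψ x := by
  ext i
  simp [grad, partialDeriv_add hφ hψ]

lemma grad_mul {φ ψ : Torus n → ℝ} (hφ : IsSmooth φ) (hψ : IsSmooth ψ) (x : Torus n) :
    grad (fun x => φ x * ψ x) x = ψ x • grad φ x + φ x • grad ψ x := by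
  ext i
  simp [grad, partialDeriv_mul hφ hψ]
  ring

lemma IsSmooth.continuous_grad {φ : Torus n → ℝ} (hφ : IsSmooth φ) : Continuous (grad φ) := by
  unfold grad
  exact (PiLp.continuous_toLp 2 _).comp (continuous_pi hφ.continuous_partialDeriv)

lemma memLp_of_continuous {E : Type*} [NormedAddCommGroup E] {p : ℝ≥0∞} {f : Torus n → E}
    [SecondCountableTopologyEither (Torus n) E] (hf : Continuous f) :
    MemLp f p (torusMeasure n) :=
  MemLp.of_bound hf.aestronglyMeasurable ‖(⟨f, hf⟩ : C(Torus n, E))‖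
    (Eventually.of_forall fun x => (⟨f, hf⟩ : C(Torus n, E)).norm_coe_le_norm x)

lemma integrable_of_continuous {f : Torus n → ℝ} (hf : Continuous f) :
    Integrable f (torusMeasure n) :=
  memLp_one_iff_integrable.1 (memLp_of_continuous hf)

/-- By translation invariance `∫ φ(x + t eᵢ) dx` does not depend on `t`; differentiating under the
integral at `t = 0` gives the claim. -/
lemma integral_partialDeriv {φ : Torus n → ℝ} (hφ : IsSmooth φ) (i : Fin n) :
    ∫ x, partialDeriv i φ x ∂torusMeasure n = 0 := by
  have hc := hφ.continuous_partialDeriv i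
  have hshift (t : ℝ) : Continuous fun x : Torus n => x + Pi.single i (t : UnitAddCircle) :=
    continuous_add_const _
  have hF (t : ℝ) : Continuous fun x : Torus n => φ (x + Pi.single i (t : UnitAddCircle)) :=
    hφ.continuous.comp (hshift t)
  have hF' (t : ℝ) :
      Continuous fun x : Torus n => partialDeriv i φ (x + Pi.single i (t : UnitAddCircle)) :=
    hc.comp (hshift t)
  have hbound (t : ℝ) (x : Torus n) : ‖partialDeriv i φ (x + Pi.single i (t : UnitAddCircle))‖ ≤
      ‖(⟨_, hc⟩ : C(Torus n, ℝ))‖ := (⟨_, hc⟩ : C(Torus n, ℝ)).norm_coe_le_norm _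
  generalize ‖(⟨_, hc⟩ : C(Torus n, ℝ))‖ = M at hbound
  have hd := fun x t => hφ.hasDerivAt i x t
  have hint := integrable_of_continuous (hF 0)
  have hmeas : ∀ᶠ t : ℝ in 𝓝 (0 : ℝ), AEStronglyMeasurable
      (fun x : Torus n => φ (x + Pi.single i (t : UnitAddCircle))) (torusMeasure n) :=
    Eventually.of_forall fun t => (hF t).aestronglyMeasurable
  have hmeas' := (hF' 0).aestronglyMeasurable (μ := torusMeasure n)
  have key := (hasDerivAt_integral_of_dominated_loc_of_deriv_le (bound := fun _ => M)
    Filter.univ_mem hmeas hint hmeas' (Eventually.of_forall fun x t _ => hbound t x)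
    (integrable_const _) (Eventually.of_forall fun x t _ => hd x t)).2
  simp only [integral_add_right_eq_self (μ := torusMeasure n) φ] at key
  simpa using (key.unique (hasDerivAt_const (0 : ℝ) (∫ x, φ x ∂torusMeasure n)))

/-- The classical gradient of a smooth function is its weak gradient. -/
lemma IsSmooth.hasWeakGradient {φ : Torus n → ℝ} (hφ : IsSmooth φ) :
    HasWeakGradient φ (grad φ) := by
  intro ψ hψ i
  have h := integral_partialDeriv (hφ.mul hψ) i
  simp only [partialDeriv_mul hφ hψ] at h
  have h1 : Continuous fun x => partialDeriv i φ x * ψ x :=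
    (hφ.continuous_partialDeriv i).mul hψ.continuous
  have h2 : Continuous fun x => φ x * partialDeriv i ψ x :=
    hφ.continuous.mul (hψ.continuous_partialDeriv i)
  rw [integral_add (integrable_of_continuous h1) (integrable_of_continuous h2)] at h
  simp only [grad]
  linarith

lemma HasWeakGradient.congr {u u' : Torus n → ℝ} {g g' : Torus n → Vec n}
    (h : HasWeakGradient u g) (hu : u' =ᵐ[torusMeasure n] u) (hg : g' =ᵐ[torusMeasure n] g) :
    HasWeakGradient u' g' := by
  intro φ hφ i
  rw [integral_congr_ae (g := fun x => u x * partialDeriv i φ x)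
      (by filter_upwards [hu] with x hx; rw [hx]),
    integral_congr_ae (f := fun x => g' x i * φ x) (g := fun x => g x i * φ x)
      (by filter_upwards [hg] with x hx; rw [hx])]
  exact h φ hφ i

/-- The mean-zero smooth function `φ` as an element of `H¹_per`. -/
def ofSmooth (φ : Torus n → ℝ) (hφ : IsSmooth φ) (h0 : ∫ x, φ x ∂torusMeasure n = 0) : H1per n :=
  ⟨WithLp.toLp 2 ((memLp_of_continuous (p := 2) hφ.continuous).toLp φ,
      (memLp_of_continuous (p := 2) hφ.continuous_grad).toLp (grad φ)),
    hφ.hasWeakGradient.congr (MemLp.coeFn_toLp (memLp_of_continuous hφ.continuous))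
      (MemLp.coeFn_toLp (memLp_of_continuous hφ.continuous_grad)),
    (integral_congr_ae (MemLp.coeFn_toLp (memLp_of_continuous (p := 2) hφ.continuous))).trans h0⟩

/-- The function `u` underlying an element of `H¹_per`. -/
def fn (u : H1per n) : Lp ℝ 2 (torusMeasure n) := (u : L2Pair n).fst

lemma fn_ofSmooth (φ : Torus n → ℝ) (hφ : IsSmooth φ) (h0 : ∫ x, φ x ∂torusMeasure n = 0) :
    fn (ofSmooth φ hφ h0) =ᵐ[torusMeasure n] φ :=
  MemLp.coeFn_toLp (memLp_of_continuous (p := 2) hφ.continuous)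

lemma D_ofSmooth (φ : Torus n → ℝ) (hφ : IsSmooth φ) (h0 : ∫ x, φ x ∂torusMeasure n = 0) :
    D (ofSmooth φ hφ h0) =ᵐ[torusMeasure n] grad φ :=
  MemLp.coeFn_toLp (memLp_of_continuous (p := 2) hφ.continuous_grad)


/-! ### Hilbert space structure of `H1per` and Poincaré's inequality -/

section L2

variable {α E : Type*} [MeasurableSpace α] {μ : Measure α} [NormedAddCommGroup E]
  [InnerProductSpace ℝ E]

lemma inner_eq_integral_of_ae {f g : Lp E 2 μ} {F G : α → E} (hF : f =ᵐ[μ] F) (hG : g =ᵐ[μ] G) :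
    ⟪f, g⟫_ℝ = ∫ x, ⟪F x, G x⟫_ℝ ∂μ := by
  rw [L2.inner_def]
  exact integral_congr_ae (by filter_upwards [hF, hG] with x h1 h2; rw [h1, h2])

lemma continuous_integral_inner {G : α → E} (hG : MemLp G 2 μ) :
    Continuous fun f : Lp E 2 μ => ∫ x, ⟪f x, G x⟫_ℝ ∂μ := by
  have h (f : Lp E 2 μ) : ∫ x, ⟪f x, G x⟫_ℝ ∂μ = ⟪f, hG.toLp G⟫_ℝ :=
    (inner_eq_integral_of_ae ae_eq_rfl hG.coeFn_toLp).symm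
  simp only [h]
  fun_prop

lemma continuous_integral_mul {ψ : α → ℝ} (hψ : MemLp ψ 2 μ) :
    Continuous fun f : Lp ℝ 2 μ => ∫ x, f x * ψ x ∂μ := by
  simpa [mul_comm] using continuous_integral_inner hψ

lemma norm_sq_eq_integral (f : Lp E 2 μ) : ‖f‖ ^ 2 = ∫ x, ‖f x‖ ^ 2 ∂μ := by
  rw [← real_inner_self_eq_norm_sq, L2.inner_def]
  simp only [real_inner_self_eq_norm_sq]

end L2

lemma continuous_integral_coord_mul {φ : Torus n → ℝ} (hφ : MemLp φ 2 (torusMeasure n))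
    (i : Fin n) :
    Continuous fun g : Lp (Vec n) 2 (torusMeasure n) => ∫ x, g x i * φ x ∂torusMeasure n := by
  have hG : MemLp (fun x => φ x • EuclideanSpace.single i (1 : ℝ)) 2 (torusMeasure n) :=
    (ContinuousLinearMap.toSpanSingleton ℝ (EuclideanSpace.single i (1 : ℝ) : Vec n)).comp_memLp' hφ
  refine (continuous_integral_inner hG).congr fun g => ?_
  simp [inner_smul_right, EuclideanSpace.inner_single_right, mul_comm]

/-- Every defining condition equates `L²` pairings with fixed continuous functions; the mean is the
pairing with 1. -/
lemma isClosed_H1per : IsClosed (H1per n : Set (L2Pair n)) := by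
  have hfst : Continuous fun w : L2Pair n => w.fst := by fun_prop
  have hsnd : Continuous fun w : L2Pair n => w.snd := by fun_prop
  have h : (H1per n : Set (L2Pair n)) =
      (⋂ (φ : Torus n → ℝ) (_ : IsSmooth φ) (i : Fin n),
        {w : L2Pair n | ∫ x, w.fst x * partialDeriv i φ x ∂torusMeasure n =
          -∫ x, w.snd x i * φ x ∂torusMeasure n}) ∩
      {w : L2Pair n | ∫ x, w.fst x * 1 ∂torusMeasure n = 0} := by
    ext w
    simp [H1per, HasWeakGradient]
  rw [h]
  refine IsClosed.inter (isClosed_iInter fun φ => isClosed_iInter fun hφ =>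
    isClosed_iInter fun i => isClosed_eq ?_ ?_) (isClosed_eq ?_ continuous_const)
  · exact (continuous_integral_mul (memLp_of_continuous (hφ.continuous_partialDeriv i))).comp hfst
  · exact ((continuous_integral_coord_mul (memLp_of_continuous hφ.continuous) i).comp hsnd).neg
  · exact (continuous_integral_mul (memLp_const 1)).comp hfst

instance completeSpace_H1per : CompleteSpace (H1per n) :=
  isClosed_H1per.completeSpace_coe

lemma norm_sq_H1per (u : H1per n) : ‖u‖ ^ 2 = ‖fn u‖ ^ 2 + ‖D u‖ ^ 2 :=
  WithLp.prod_norm_sq_eq_of_L2 (u : L2Pair n)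

lemma inner_H1per (u v : H1per n) : ⟪u, v⟫_ℝ = ⟪fn u, fn v⟫_ℝ + ⟪D u, D v⟫_ℝ :=
  WithLp.prod_inner_apply (u : L2Pair n) v

lemma hasWeakGradient_D (u : H1per n) : HasWeakGradient (fn u) (D u) := u.2.1

lemma integral_fn (u : H1per n) : ∫ x, fn u x ∂torusMeasure n = 0 := u.2.2

lemma norm_sq_eq_sum_integral (g : Lp (Vec n) 2 (torusMeasure n)) :
    ‖g‖ ^ 2 = ∑ i, ∫ x, g x i ^ 2 ∂torusMeasure n := by
  rw [norm_sq_eq_integral, ← integral_finsetSum]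
  · simp only [EuclideanSpace.norm_sq_eq, Real.norm_eq_abs, sq_abs]
  · exact fun i _ => (memLp_coord (Lp.memLp g) i).integrable_sq

lemma cosCoeff_zero (u : H1per n) : cosCoeff (fn u) 0 = 0 := by
  simp [cosCoeff, cosMode_zero, integral_fn]

lemma sinCoeff_zero (f : Torus n → ℝ) : sinCoeff f 0 = 0 := by
  simp [sinCoeff, sinMode_zero]

lemma one_le_sum_sq_of_ne_zero {k : Fin n → ℤ} (hk : k ≠ 0) : (1 : ℝ) ≤ ∑ i, (k i : ℝ) ^ 2 := by
  obtain ⟨i, hi⟩ := Function.ne_iff.1 hk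
  have h1 : (1 : ℝ) ≤ (k i : ℝ) ^ 2 := by
    have : (1 : ℤ) ≤ k i ^ 2 := Int.add_one_le_of_lt (by simpa using sq_pos_of_ne_zero hi)
    exact_mod_cast this
  exact h1.trans (Finset.single_le_sum (f := fun i => (k i : ℝ) ^ 2)
    (fun j _ => sq_nonneg _) (Finset.mem_univ i))

/-- **Poincaré's inequality** on the torus with the sharp constant. -/
lemma norm_fn_le (u : H1per n) : ‖fn u‖ ≤ 1 / (2 * Real.pi) * ‖D u‖ := by
  have hpi := Real.pi_pos
  have h1 := hasSum_sq_coeff (Lp.memLp (fn u))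
  have h2 := hasSum_sum (s := Finset.univ)
    fun i _ => hasSum_sq_coeff (memLp_coord (Lp.memLp (D u)) i)
  rw [← norm_sq_eq_sum_integral] at h2
  have h3 : ∫ x, fn u x ^ 2 ∂torusMeasure n = ‖fn u‖ ^ 2 := by
    rw [norm_sq_eq_integral]
    simp
  rw [h3] at h1
  have h4 : (2 * Real.pi) ^ 2 * ‖fn u‖ ^ 2 ≤ ‖D u‖ ^ 2 := by
    -- The two Parseval series are compared frequency by frequency.
    refine hasSum_le (fun k => ?_) (h1.mul_left ((2 * Real.pi) ^ 2)) h2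
    simp only [cosCoeff_of_hasWeakGradient (hasWeakGradient_D u),
      sinCoeff_of_hasWeakGradient (hasWeakGradient_D u)]
    have h5 : ∑ i, ((2 * Real.pi * k i * sinCoeff (fn u) k) ^ 2 +
        (-(2 * Real.pi * k i * cosCoeff (fn u) k)) ^ 2) =
        (2 * Real.pi) ^ 2 * (cosCoeff (fn u) k ^ 2 + sinCoeff (fn u) k ^ 2) *
          ∑ i, (k i : ℝ) ^ 2 := by
      rw [Finset.mul_sum]
      exact Finset.sum_congr rfl fun i _ => by ring
    rw [h5]
    -- The zero frequency is absent because the mean vanishes; at any other one `|k|² ≥ 1`.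
    by_cases hk : k = 0
    · subst hk
      simp [cosCoeff_zero, sinCoeff_zero]
    · exact le_mul_of_one_le_right (by positivity) (one_le_sum_sq_of_ne_zero hk)
  rw [← mul_pow] at h4
  have h6 := (sq_le_sq₀ (by positivity) (norm_nonneg _)).1 h4
  rw [div_mul_eq_mul_div, le_div_iff₀ (by positivity), one_mul, mul_comm]
  exact h6

lemma eq_zero_of_coeff_eq_zero (f : Lp ℝ 2 (torusMeasure n)) (hc : ∀ k, cosCoeff f k = 0)
    (hs : ∀ k, sinCoeff f k = 0) : f = 0 := by
  have h := hasSum_sq_coeff (Lp.memLp f)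
  simp only [hc, hs] at h
  have h2 : ‖f‖ ^ 2 = 0 := by
    rw [norm_sq_eq_integral]
    simpa using h.unique (by simp)
  simpa using h2

/-- Poincaré makes the gradient norm equivalent to the full norm. The constant 2 is a convenient
weakening of `√2`. -/
lemma norm_le_D (u : H1per n) : ‖u‖ ≤ 2 * ‖D u‖ := by
  have h1 := norm_sq_H1per u
  have h2 := norm_fn_le u
  have h3 : 1 / (2 * Real.pi) ≤ 1 := by
    rw [div_le_one (by positivity)]
    linarith [Real.pi_gt_three]
  have h4 : ‖fn u‖ ≤ ‖D u‖ := h2.trans (mul_le_of_le_one_left (norm_nonneg _) h3)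
  nlinarith [norm_nonneg u, norm_nonneg (fn u), norm_nonneg (D u)]

/-! ### Density of smooth functions -/

/-- The functional `w ↦ (w, φ)_{H¹}` for smooth `φ`. -/
lemma inner_ofSmooth (w : H1per n) {φ : Torus n → ℝ} (hφ : IsSmooth φ)
    (h0 : ∫ x, φ x ∂torusMeasure n = 0) :
    ⟪w, ofSmooth φ hφ h0⟫_ℝ = ∫ x, fn w x * φ x ∂torusMeasure n +
      ∑ i, ∫ x, D w x i * partialDeriv i φ x ∂torusMeasure n := by
  rw [inner_H1per, inner_eq_integral_of_ae ae_eq_rfl (fn_ofSmooth φ hφ h0),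
    inner_eq_integral_of_ae ae_eq_rfl (D_ofSmooth φ hφ h0), ← integral_finsetSum]
  · simp [PiLp.inner_apply, grad, mul_comm]
  · exact fun i _ => integrable_mul_of_continuous (memLp_coord (Lp.memLp (D w)) i)
      (hφ.continuous_partialDeriv i)

/-- The mean-zero smooth functions in `H¹_per`. -/
def smoothSet (n : ℕ) : Set (H1per n) :=
  {w | ∃ (φ : Torus n → ℝ) (hφ : IsSmooth φ) (h0 : ∫ x, φ x ∂torusMeasure n = 0),
    w = ofSmooth φ hφ h0}

/-- Up to a nonzero factor the mode is a partial derivative of the sine mode. -/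
lemma integral_cosMode {k : Fin n → ℤ} (hk : k ≠ 0) : ∫ x, cosMode k x ∂torusMeasure n = 0 := by
  obtain ⟨i, hi⟩ := Function.ne_iff.1 hk
  have h := integral_partialDeriv (isSmooth_sinMode k) i
  simp only [partialDeriv_sinMode, integral_const_mul] at h
  exact (mul_eq_zero.1 h).resolve_left (by simpa [Real.pi_ne_zero] using hi)

lemma integral_sinMode {k : Fin n → ℤ} (hk : k ≠ 0) : ∫ x, sinMode k x ∂torusMeasure n = 0 := by
  obtain ⟨i, hi⟩ := Function.ne_iff.1 hk
  have h := integral_partialDeriv (isSmooth_cosMode k) i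
  simp only [partialDeriv_cosMode, integral_const_mul] at h
  exact (mul_eq_zero.1 h).resolve_left (by simpa [Real.pi_ne_zero] using hi)

/-- Pairing with a nonconstant mode multiplies the corresponding coefficient of `fn w` by `1 +
4π²|k|²`, which is positive. -/
lemma coeff_eq_zero_of_orthogonal {w : H1per n}
    (hw : ∀ (φ : Torus n → ℝ) (hφ : IsSmooth φ) (h0 : ∫ x, φ x ∂torusMeasure n = 0),
      ⟪w, ofSmooth φ hφ h0⟫_ℝ = 0) (k : Fin n → ℤ) :
    cosCoeff (fn w) k = 0 ∧ sinCoeff (fn w) k = 0 := by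
  by_cases hk : k = 0
  · subst hk
    exact ⟨cosCoeff_zero w, sinCoeff_zero _⟩
  have hpos : (0 : ℝ) < 1 + (2 * Real.pi) ^ 2 * ∑ i, (k i : ℝ) ^ 2 := by
    have : (0 : ℝ) ≤ ∑ i, (k i : ℝ) ^ 2 := Finset.sum_nonneg fun i _ => sq_nonneg _
    positivity
  have hcos (i : Fin n) : ∫ x, D w x i * partialDeriv i (cosMode k) x ∂torusMeasure n =
      (2 * Real.pi) ^ 2 * k i ^ 2 * cosCoeff (fn w) k := by
    have h := sinCoeff_of_hasWeakGradient (hasWeakGradient_D w) k i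
    simp only [sinCoeff] at h
    simp only [partialDeriv_cosMode, mul_left_comm _ (-(2 * Real.pi * (k i : ℝ)))]
    rw [integral_const_mul, h]
    ring
  have hsin (i : Fin n) : ∫ x, D w x i * partialDeriv i (sinMode k) x ∂torusMeasure n =
      (2 * Real.pi) ^ 2 * k i ^ 2 * sinCoeff (fn w) k := by
    have h := cosCoeff_of_hasWeakGradient (hasWeakGradient_D w) k i
    simp only [cosCoeff] at h
    simp only [partialDeriv_sinMode, mul_left_comm _ (2 * Real.pi * (k i : ℝ))]
    rw [integral_const_mul, h]
    ring
  constructor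
  · have h := hw _ (isSmooth_cosMode k) (integral_cosMode hk)
    rw [inner_ofSmooth] at h
    simp only [hcos] at h
    rw [← Finset.sum_mul, ← Finset.mul_sum, ← cosCoeff, ← one_add_mul] at h
    exact (mul_eq_zero.1 h).resolve_left hpos.ne'
  · have h := hw _ (isSmooth_sinMode k) (integral_sinMode hk)
    rw [inner_ofSmooth] at h
    simp only [hsin] at h
    rw [← Finset.sum_mul, ← Finset.mul_sum, ← sinCoeff, ← one_add_mul] at h
    exact (mul_eq_zero.1 h).resolve_left hpos.ne'

/-- An element of `H1per` is a pair, so this expresses uniqueness of the weak gradient: its Fourier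
coefficients are determined by those of the function. -/
lemma eq_zero_of_fn_eq_zero {w : H1per n} (h : fn w = 0) : w = 0 := by
  have h0 : (fn w : Torus n → ℝ) =ᵐ[torusMeasure n] 0 := by
    rw [h]
    exact Lp.coeFn_zero _ _ _
  have hD : ‖D w‖ ^ 2 = 0 := by
    rw [norm_sq_eq_sum_integral]
    refine Finset.sum_eq_zero fun i _ => ?_
    refine (hasSum_sq_coeff (memLp_coord (Lp.memLp (D w)) i)).unique ?_
    have hc (ψ : Torus n → ℝ) : ∫ x, fn w x * ψ x ∂torusMeasure n = 0 := by
      rw [integral_congr_ae (g := fun _ => (0 : ℝ))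
        (by filter_upwards [h0] with x hx; rw [hx]; simp)]
      simp
    have hcos (k : Fin n → ℤ) : cosCoeff (fn w) k = 0 := hc _
    have hsin (k : Fin n → ℤ) : sinCoeff (fn w) k = 0 := hc _
    simp [cosCoeff_of_hasWeakGradient (hasWeakGradient_D w),
      sinCoeff_of_hasWeakGradient (hasWeakGradient_D w), hcos, hsin]
  have hD' : ‖D w‖ = 0 := by simpa using hD
  have := norm_le_D w
  rw [hD', mul_zero] at this
  exact norm_le_zero_iff.1 this

/-- Smooth functions are dense in `H¹_per`. -/
lemma dense_span_smoothSet : Dense (Submodule.span ℝ (smoothSet n) : Set (H1per n)) := by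
  rw [Submodule.dense_iff_topologicalClosure_eq_top, Submodule.topologicalClosure_eq_top_iff,
    Submodule.eq_bot_iff]
  intro w hw
  have h := coeff_eq_zero_of_orthogonal (w := w) fun φ hφ h0 =>
    Submodule.inner_left_of_mem_orthogonal (K := Submodule.span ℝ (smoothSet n))
      (Submodule.subset_span ⟨φ, hφ, h0, rfl⟩) hw
  exact eq_zero_of_fn_eq_zero (eq_zero_of_coeff_eq_zero _ (fun k => (h k).1) fun k => (h k).2)


/-! ### The drift form and the variational formulation -/

/-- The weak gradient as a continuous linear map. -/
def DL (n : ℕ) : H1per n →L[ℝ] Lp (Vec n) 2 (torusMeasure n) :=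
  (WithLp.sndL 2 ℝ _ _).comp (H1per n).subtypeL

/-- The embedding of `H¹_per` into `L²` as a continuous linear map. -/
def fnL (n : ℕ) : H1per n →L[ℝ] Lp ℝ 2 (torusMeasure n) :=
  (WithLp.fstL 2 ℝ _ _).comp (H1per n).subtypeL

@[simp] lemma DL_apply (u : H1per n) : DL n u = D u := rfl

lemma D_sub (u v : H1per n) : D (u - v) = D u - D v := rfl

variable {V : Torus n → Vec n}

/-- Multiplication `g ↦ V · g` from `L²` to `L²` for bounded `V`. -/
def mulL (hV : MemLp V ∞ (torusMeasure n)) :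
    Lp (Vec n) 2 (torusMeasure n) →L[ℝ] Lp ℝ 2 (torusMeasure n) :=
  (innerSL ℝ : Vec n →L[ℝ] Vec n →L[ℝ] ℝ).holderL (torusMeasure n) ∞ 2 2 (hV.toLp V)

lemma coeFn_mulL (hV : MemLp V ∞ (torusMeasure n)) (g : Lp (Vec n) 2 (torusMeasure n)) :
    mulL hV g =ᵐ[torusMeasure n] fun x => ⟪V x, g x⟫_ℝ := by
  have h1 : mulL hV g =ᵐ[torusMeasure n] fun x => ⟪hV.toLp V x, g x⟫_ℝ :=
    (innerSL ℝ : Vec n →L[ℝ] Vec n →L[ℝ] ℝ).coeFn_holder _ _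
  filter_upwards [h1, hV.coeFn_toLp] with x hx hx'
  rw [hx, hx']

/-- The drift form `(v, φ) ↦ ∫ (V · Dv) φ`. -/
def driftForm (hV : MemLp V ∞ (torusMeasure n)) : H1per n →L[ℝ] H1per n →L[ℝ] ℝ :=
  (innerSL ℝ).bilinearComp ((mulL hV).comp (DL n)) (fnL n)

lemma driftForm_apply (hV : MemLp V ∞ (torusMeasure n)) (v w : H1per n) :
    driftForm hV v w = ⟪mulL hV (D v), fn w⟫_ℝ := rfl

lemma driftForm_ofSmooth (hV : MemLp V ∞ (torusMeasure n)) {φ ψ : Torus n → ℝ}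
    (hφ : IsSmooth φ) (hψ : IsSmooth ψ) (hφ0 : ∫ x, φ x ∂torusMeasure n = 0)
    (hψ0 : ∫ x, ψ x ∂torusMeasure n = 0) :
    driftForm hV (ofSmooth φ hφ hφ0) (ofSmooth ψ hψ hψ0) =
      ∫ x, ⟪V x, ψ x • grad φ x⟫_ℝ ∂torusMeasure n := by
  have h : mulL hV (D (ofSmooth φ hφ hφ0)) =ᵐ[torusMeasure n] fun x => ⟪V x, grad φ x⟫_ℝ := by
    filter_upwards [coeFn_mulL hV (D (ofSmooth φ hφ hφ0)), D_ofSmooth φ hφ hφ0] with x h1 h2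
    rw [h1, h2]
  rw [driftForm_apply, inner_eq_integral_of_ae h (fn_ofSmooth ψ hψ hψ0)]
  simp [inner_smul_right]

lemma integrable_inner_of_continuous (hV : MemLp V ∞ (torusMeasure n)) {G : Torus n → Vec n}
    (hG : Continuous G) : Integrable (fun x => ⟪V x, G x⟫_ℝ) (torusMeasure n) := by
  have hV2 : MemLp V 2 (torusMeasure n) := hV.mono_exponent le_top
  have hG2 : MemLp G 2 (torusMeasure n) := memLp_of_continuous hG
  refine (L2.integrable_inner (𝕜 := ℝ) (hV2.toLp V) (hG2.toLp G)).congr ?_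
  filter_upwards [hV2.coeFn_toLp, hG2.coeFn_toLp] with x h1 h2
  rw [h1, h2]

/-- For smooth `φ, ψ` the sum is `∫ V · D(φψ) = 0` by the product rule; density and continuity
extend this in each argument separately. -/
lemma driftForm_antisymm (hV : MemLp V ∞ (torusMeasure n)) (hdiv : IsDivFree V) (v w : H1per n) :
    driftForm hV v w + driftForm hV w v = 0 := by
  have key : driftForm hV + (driftForm hV).flip = 0 := by
    refine ContinuousLinearMap.ext_on dense_span_smoothSet ?_
    rintro _ ⟨φ, hφ, hφ0, rfl⟩
    refine ContinuousLinearMap.ext_on dense_span_smoothSet ?_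
    rintro _ ⟨ψ, hψ, hψ0, rfl⟩
    simp only [add_apply, ContinuousLinearMap.flip_apply,
      zero_apply, driftForm_ofSmooth]
    have h1 : Continuous fun x => ψ x • grad φ x := hψ.continuous.smul hφ.continuous_grad
    have h2 : Continuous fun x => φ x • grad ψ x := hφ.continuous.smul hψ.continuous_grad
    rw [← integral_add (integrable_inner_of_continuous hV h1)
      (integrable_inner_of_continuous hV h2), ← hdiv _ (hφ.mul hψ)]
    simp only [grad_mul hφ hψ, inner_add_right]
  exact congr($key v w)

lemma driftForm_self (hV : MemLp V ∞ (torusMeasure n)) (hdiv : IsDivFree V) (v : H1per n) :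
    driftForm hV v v = 0 := by
  linarith [driftForm_antisymm hV hdiv v v]

/-- The drift term has mean zero, so constants can be added to or removed from test functions
freely. -/
lemma integral_inner_D (hV : MemLp V ∞ (torusMeasure n)) (hdiv : IsDivFree V) (v : H1per n) :
    ∫ x, ⟪V x, D v x⟫_ℝ ∂torusMeasure n = 0 := by
  have hV2 : MemLp V 2 (torusMeasure n) := hV.mono_exponent le_top
  have key : (innerSL ℝ (hV2.toLp V)).comp (DL n) = 0 := by
    refine ContinuousLinearMap.ext_on dense_span_smoothSet ?_
    rintro _ ⟨φ, hφ, hφ0, rfl⟩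
    simp only [ContinuousLinearMap.comp_apply, DL_apply, innerSL_apply_apply,
      zero_apply]
    rw [inner_eq_integral_of_ae hV2.coeFn_toLp (D_ofSmooth φ hφ hφ0), hdiv φ hφ]
  rw [← inner_eq_integral_of_ae hV2.coeFn_toLp (g := D v) ae_eq_rfl]
  exact congr($key v)

/-- The bilinear form of `-c Δ + V · D`. -/
def weakForm (c : ℝ) (hV : MemLp V ∞ (torusMeasure n)) : H1per n →L[ℝ] H1per n →L[ℝ] ℝ :=
  c • ((innerSL ℝ).bilinearComp (DL n) (DL n) : H1per n →L[ℝ] H1per n →L[ℝ] ℝ) + driftForm hV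

lemma weakForm_apply (c : ℝ) (hV : MemLp V ∞ (torusMeasure n)) (v w : H1per n) :
    weakForm c hV v w = c * ⟪D v, D w⟫_ℝ + ⟪mulL hV (D v), fn w⟫_ℝ := rfl

lemma weakForm_self (c : ℝ) (hV : MemLp V ∞ (torusMeasure n)) (hdiv : IsDivFree V)
    (v : H1per n) : weakForm c hV v v = c * ‖D v‖ ^ 2 := by
  rw [weakForm_apply, ← driftForm_apply, driftForm_self hV hdiv, real_inner_self_eq_norm_sq,
    add_zero]

lemma isCoercive_weakForm {c : ℝ} (hc : 0 < c) (hV : MemLp V ∞ (torusMeasure n))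
    (hdiv : IsDivFree V) : IsCoercive (weakForm c hV) := by
  -- The 4 is the square of the constant in `norm_le_D`.
  refine ⟨c / 4, by positivity, fun v => ?_⟩
  rw [weakForm_self c hV hdiv]
  have h := mul_self_le_mul_self (norm_nonneg v) (norm_le_D v)
  nlinarith

lemma weakForm_ofSmooth (c : ℝ) (hV : MemLp V ∞ (torusMeasure n)) (v : H1per n)
    {φ : Torus n → ℝ} (hφ : IsSmooth φ) (h0 : ∫ x, φ x ∂torusMeasure n = 0) :
    weakForm c hV v (ofSmooth φ hφ h0) = c * ∫ x, ⟪D v x, grad φ x⟫_ℝ ∂torusMeasure n +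
      ∫ x, ⟪V x, D v x⟫_ℝ * φ x ∂torusMeasure n := by
  rw [weakForm_apply, inner_eq_integral_of_ae ae_eq_rfl (D_ofSmooth φ hφ h0),
    inner_eq_integral_of_ae (coeFn_mulL hV _) (fn_ofSmooth φ hφ h0)]
  simp [mul_comm]

/-- Weak solutions are exactly the solutions of the variational problem in `H¹_per`, provided the
right-hand side has mean zero. -/
lemma isWeakSolution_iff (c : ℝ) (hV : MemLp V ∞ (torusMeasure n)) (hdiv : IsDivFree V)
    {f : Torus n → ℝ} (hf : MemLp f 2 (torusMeasure n)) (v : H1per n) :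
    IsWeakSolution c V f v ↔
      ∫ x, f x ∂torusMeasure n = 0 ∧ ∀ w, weakForm c hV v w = ⟪hf.toLp f, fn w⟫_ℝ := by
  have hfw {φ : Torus n → ℝ} (hφ : IsSmooth φ) (h0 : ∫ x, φ x ∂torusMeasure n = 0) :
      ⟪hf.toLp f, fn (ofSmooth φ hφ h0)⟫_ℝ = ∫ x, f x * φ x ∂torusMeasure n := by
    rw [inner_eq_integral_of_ae hf.coeFn_toLp (fn_ofSmooth φ hφ h0)]
    simp [mul_comm]
  constructor
  · intro h
    refine ⟨?_, fun w => ?_⟩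
    -- Tested with 1, both terms on the left vanish.
    · have h1 := h _ (isSmooth_const 1)
      simpa [grad_const, integral_inner_D hV hdiv] using h1.symm
    · have key : weakForm c hV v = (innerSL ℝ (hf.toLp f)).comp (fnL n) := by
        refine ContinuousLinearMap.ext_on dense_span_smoothSet ?_
        rintro _ ⟨φ, hφ, hφ0, rfl⟩
        rw [weakForm_ofSmooth, h φ hφ]
        exact (hfw hφ hφ0).symm
      exact congr($key w)
  · rintro ⟨hf0, h⟩ φ hφ
    -- Subtracting the mean of `φ` yields an admissible element of `H1per` and changes no term of
    -- the identity.
    set m := ∫ x, φ x ∂torusMeasure n with hm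
    have hψ : IsSmooth fun x => φ x + -m := hφ.add (isSmooth_const _)
    have hψ0 : ∫ x, φ x + -m ∂torusMeasure n = 0 := by
      rw [integral_add (integrable_of_continuous hφ.continuous) (integrable_const _)]
      simp [hm]
    have h1 := h (ofSmooth _ hψ hψ0)
    have hN : MemLp (fun x => ⟪V x, D v x⟫_ℝ) 2 (torusMeasure n) :=
      (Lp.memLp (mulL hV (D v))).ae_eq (coeFn_mulL hV (D v))
    rw [weakForm_ofSmooth, hfw] at h1
    simp only [grad_add hφ (isSmooth_const _), grad_const, add_zero, mul_add] at h1
    rw [integral_add (integrable_mul_of_continuous hf hφ.continuous)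
        ((hf.integrable (by norm_num)).mul_const _),
      integral_add (integrable_mul_of_continuous hN hφ.continuous)
        ((hN.integrable (by norm_num)).mul_const _),
      integral_mul_const, integral_mul_const, hf0, integral_inner_D hV hdiv] at h1
    simpa using h1


/-! ### The nonlinear term and the iteration step -/

lemma memLp_norm_const_add (P : Vec n) (g : Lp (Vec n) 2 (torusMeasure n)) :
    MemLp (fun x => ‖P + g x‖) 2 (torusMeasure n) :=
  ((memLp_const P).add (Lp.memLp g)).norm

/-- The function `|P + g|` in `L²`. -/
def burning (P : Vec n) (g : Lp (Vec n) 2 (torusMeasure n)) : Lp ℝ 2 (torusMeasure n) :=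
  (memLp_norm_const_add P g).toLp _

lemma norm_burning_sub_le (P : Vec n) (g h : Lp (Vec n) 2 (torusMeasure n)) :
    ‖burning P g - burning P h‖ ≤ ‖g - h‖ := by
  refine Lp.norm_le_norm_of_ae_le ?_
  filter_upwards [Lp.coeFn_sub (burning P g) (burning P h), Lp.coeFn_sub g h,
    (memLp_norm_const_add P g).coeFn_toLp, (memLp_norm_const_add P h).coeFn_toLp]
    with x h1 h2 h3 h4
  rw [h1, h2, Pi.sub_apply, Pi.sub_apply, burning, burning, h3, h4]
  calc ‖‖P + g x‖ - ‖P + h x‖‖ ≤ ‖P + g x - (P + h x)‖ := abs_norm_sub_norm_le _ _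
    _ = ‖g x - h x‖ := by rw [add_sub_add_left_eq_sub]

lemma continuous_burning (P : Vec n) : Continuous (burning P) :=
  (LipschitzWith.of_dist_le_mul (K := 1) fun g h => by
    simpa [dist_eq_norm] using norm_burning_sub_le P g h).continuous

lemma continuous_D : Continuous (D : H1per n → Lp (Vec n) 2 (torusMeasure n)) :=
  (DL n).continuous

lemma continuous_meanBurning (sL : ℝ) (P : Vec n) :
    Continuous (meanBurning sL P : H1per n → ℝ) := by
  have h (u : H1per n) : meanBurning sL P u =
      sL * ∫ x, burning P (D u) x * 1 ∂torusMeasure n := by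
    rw [meanBurning]
    congr 1
    refine integral_congr_ae ?_
    filter_upwards [(memLp_norm_const_add P (D u)).coeFn_toLp] with x hx
    rw [burning, hx, mul_one]
  rw [funext h]
  exact continuous_const.mul ((continuous_integral_mul (memLp_const 1)).comp
    ((continuous_burning P).comp continuous_D))

lemma memLp_inner_const (hV : MemLp V ∞ (torusMeasure n)) (P : Vec n) :
    MemLp (fun x => ⟪V x, P⟫_ℝ) 2 (torusMeasure n) := by
  simpa [real_inner_comm, Function.comp_def] using
    (innerSL ℝ P : Vec n →L[ℝ] ℝ).comp_memLp' (hV.mono_exponent (p := 2) le_top)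

lemma integral_inner_const (hV : MemLp V ∞ (torusMeasure n))
    (hV_mean : ∫ x, V x ∂torusMeasure n = 0) (P : Vec n) :
    ∫ x, ⟪V x, P⟫_ℝ ∂torusMeasure n = 0 := by
  have h := integral_inner (𝕜 := ℝ) (hV.integrable le_top) P
  rw [hV_mean, inner_zero_right] at h
  simpa only [real_inner_comm] using h

/-- The variational form of `-c Δv + V · Dv = H - s_L |P + Du| - V · P`; solvability forces
`H = s_L ∫ |P + Du|`. -/
lemma isWeakSolution_burning_iff (c sL H : ℝ) (hV : MemLp V ∞ (torusMeasure n))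
    (hV_mean : ∫ x, V x ∂torusMeasure n = 0) (hdiv : IsDivFree V) (P : Vec n) (u v : H1per n) :
    IsWeakSolution c V (fun x => H - sL * ‖P + D u x‖ - ⟪V x, P⟫_ℝ) v ↔
      H = meanBurning sL P u ∧ ∀ w, weakForm c hV v w =
        ⟪-sL • burning P (D u) - (memLp_inner_const hV P).toLp _, fn w⟫_ℝ := by
  have hb := memLp_norm_const_add P (D u)
  have hp := memLp_inner_const hV P
  have hH : MemLp (fun _ : Torus n => H) 2 (torusMeasure n) := memLp_const H
  have hf : MemLp (fun x => H - sL * ‖P + D u x‖ - ⟪V x, P⟫_ℝ) 2 (torusMeasure n) :=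
    (hH.sub (hb.const_mul sL)).sub hp
  -- Constants are orthogonal to mean-zero functions, so `H` enters only through the solvability
  -- condition.
  have hHw (w : H1per n) : ⟪hH.toLp _, fn w⟫_ℝ = 0 := by
    rw [inner_eq_integral_of_ae hH.coeFn_toLp ae_eq_rfl]
    simp
    simp [integral_mul_const, integral_fn]
  have hfL : hf.toLp _ = hH.toLp _ + (-sL • burning P (D u) - hp.toLp _) := by
    rw [burning, ← MemLp.toLp_const_smul, ← MemLp.toLp_sub, ← MemLp.toLp_add]
    refine MemLp.toLp_congr _ _ (Eventually.of_forall fun x => ?_)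
    simp
    ring
  rw [isWeakSolution_iff c hV hdiv hf]
  refine and_congr ?_ (forall_congr' fun w => ?_)
  · have hHb : MemLp (fun x => H - sL * ‖P + D u x‖) 2 (torusMeasure n) :=
      hH.sub (hb.const_mul sL)
    rw [integral_sub (hHb.integrable (by norm_num)) (hp.integrable (by norm_num)), integral_sub (integrable_const _)
      ((hb.const_mul sL).integrable (by norm_num)), integral_inner_const hV hV_mean,
      integral_const_mul, meanBurning]
    simp [sub_eq_zero]
  · rw [hfL, inner_add_left, hHw, zero_add]

/-- Lax–Milgram, with the right-hand side represented by the Riesz vector `r`; the solvability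
condition holds by the choice of `H`. -/
lemma existsUnique_isIterationStep {d sL : ℝ} (hd : 0 < d) (hsL : 0 < sL)
    (hV : MemLp V ∞ (torusMeasure n)) (hV_mean : ∫ x, V x ∂torusMeasure n = 0)
    (hdiv : IsDivFree V) (P : Vec n) (u : H1per n) :
    ∃! v : H1per n, IsIterationStep d sL V P u v := by
  have hco := isCoercive_weakForm (mul_pos hd hsL) hV hdiv
  set F := (innerSL ℝ (-sL • burning P (D u) - (memLp_inner_const hV P).toLp _)).comp (fnL n)
  set r := (InnerProductSpace.toDual ℝ (H1per n)).symm F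
  have hiff (v : H1per n) : IsIterationStep d sL V P u v ↔
      hco.continuousLinearEquivOfBilin v = r := by
    rw [IsIterationStep, isWeakSolution_burning_iff _ _ _ hV hV_mean hdiv]
    simp only [true_and]
    rw [ext_iff_inner_right ℝ]
    refine forall_congr' fun w => ?_
    rw [hco.continuousLinearEquivOfBilin_apply, InnerProductSpace.toDual_symm_apply]
    rfl
  simp only [hiff]
  exact hco.continuousLinearEquivOfBilin.bijective.existsUnique r

/-- The iteration step contracts gradients by the factor `1 / (2πd)`. -/
lemma norm_D_sub_le_of_isIterationStep {d sL : ℝ} (hd : 0 < d) (hsL : 0 < sL)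
    (hV : MemLp V ∞ (torusMeasure n)) (hV_mean : ∫ x, V x ∂torusMeasure n = 0)
    (hdiv : IsDivFree V) {P : Vec n} {u₁ u₂ v₁ v₂ : H1per n}
    (h₁ : IsIterationStep d sL V P u₁ v₁) (h₂ : IsIterationStep d sL V P u₂ v₂) :
    ‖D v₁ - D v₂‖ ≤ 1 / (2 * Real.pi * d) * ‖D u₁ - D u₂‖ := by
  rw [IsIterationStep, isWeakSolution_burning_iff _ _ _ hV hV_mean hdiv] at h₁ h₂
  have hpi := Real.pi_pos
  set w := v₁ - v₂ with hw
  have h := weakForm_self (d * sL) hV hdiv w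
  have hsub : weakForm (d * sL) hV w w =
      weakForm (d * sL) hV v₁ w - weakForm (d * sL) hV v₂ w := by
    rw [← sub_apply, ← map_sub]
  rw [hsub, h₁.2 w, h₂.2 w, ← inner_sub_left, sub_sub_sub_cancel_right,
    ← smul_sub, real_inner_smul_left] at h
  have hCS := abs_real_inner_le_norm (burning P (D u₁) - burning P (D u₂)) (fn w)
  -- Cauchy–Schwarz, the Lipschitz bound for `burning`, and Poincaré for `w`.
  have hle : d * sL * ‖D w‖ ^ 2 ≤ sL * (‖D u₁ - D u₂‖ * (1 / (2 * Real.pi) * ‖D w‖)) := by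
    rw [← h, neg_mul, ← mul_neg]
    refine mul_le_mul_of_nonneg_left (((neg_le_abs _).trans hCS).trans ?_) hsL.le
    exact mul_le_mul (norm_burning_sub_le P _ _) (norm_fn_le w) (norm_nonneg _) (norm_nonneg _)
  rw [← D_sub, ← hw]
  rcases (norm_nonneg (D w)).eq_or_lt with h0 | h0
  · rw [← h0]
    positivity
  · have h2 : (d * sL * ‖D w‖) * ‖D w‖ ≤ (sL * (‖D u₁ - D u₂‖ * (1 / (2 * Real.pi)))) * ‖D w‖ := by
      linarith
    have h3 := le_of_mul_le_mul_right h2 h0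
    have h4 : d * ‖D w‖ ≤ ‖D u₁ - D u₂‖ * (1 / (2 * Real.pi)) := by
      refine le_of_mul_le_mul_left ?_ hsL
      linarith
    have h5 : 1 / (2 * Real.pi * d) * ‖D u₁ - D u₂‖ =
        ‖D u₁ - D u₂‖ * (1 / (2 * Real.pi)) / d := by
      field_simp
    rw [h5, le_div_iff₀ hd, mul_comm]
    exact h4

/-- In the corrector problem `H` is free; the solvability condition fixes it, and what remains is
the fixed-point equation. -/
lemma isCorrector_iff {d sL : ℝ} (hV : MemLp V ∞ (torusMeasure n))
    (hV_mean : ∫ x, V x ∂torusMeasure n = 0) (hdiv : IsDivFree V) (P : Vec n) (u : H1per n)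
    (H : ℝ) : IsCorrector d sL V P u H ↔
      H = meanBurning sL P u ∧ IsIterationStep d sL V P u u := by
  rw [IsCorrector, IsIterationStep, isWeakSolution_burning_iff _ _ _ hV hV_mean hdiv,
    isWeakSolution_burning_iff _ _ _ hV hV_mean hdiv]
  simp

/-! ### Fixed points of gradient contractions -/

lemma tendsto_of_norm_D_sub_le {q : ℝ} (hq0 : 0 ≤ q) (hq1 : q < 1) {u : ℕ → H1per n}
    {a : H1per n} (h : ∀ k, ‖D (u (k + 1)) - D a‖ ≤ q * ‖D (u k) - D a‖) :
    Tendsto u atTop (𝓝 a) := by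
  have hk (k : ℕ) : ‖D (u k) - D a‖ ≤ q ^ k * ‖D (u 0) - D a‖ := by
    induction k with
    | zero => simp
    | succ k ih =>
      calc _ ≤ q * ‖D (u k) - D a‖ := h k
        _ ≤ q * (q ^ k * ‖D (u 0) - D a‖) := mul_le_mul_of_nonneg_left ih hq0
        _ = _ := by ring
  rw [tendsto_iff_norm_sub_tendsto_zero]
  refine squeeze_zero (fun _ => norm_nonneg _)
    (fun k => (norm_le_D _).trans (mul_le_mul_of_nonneg_left (hk k) zero_le_two)) ?_
  simpa using ((tendsto_pow_atTop_nhds_zero_of_lt_one hq0 hq1).mul_const _).const_mul 2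

/-- A map of `H¹_per` that contracts gradients has a fixed point. -/
lemma exists_fixedPoint_of_norm_D_sub_le {q : ℝ} (hq0 : 0 ≤ q) (hq1 : q < 1)
    {T : H1per n → H1per n} (hT : ∀ u v, ‖D (T u) - D (T v)‖ ≤ q * ‖D u - D v‖) :
    ∃ a, T a = a := by
  -- The contraction is measured in the gradient norm, so the Picard iterates are followed there and
  -- carried to the `H¹` norm by `norm_le_D`.
  set u : ℕ → H1per n := fun k => T^[k] 0
  have hu (k : ℕ) : u (k + 1) = T (u k) := Function.iterate_succ_apply' T k 0
  have hk (k : ℕ) : ‖D (u k) - D (u (k + 1))‖ ≤ q ^ k * ‖D (u 0) - D (u 1)‖ := by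
    induction k with
    | zero => simp
    | succ k ih =>
      calc _ ≤ q * ‖D (u k) - D (u (k + 1))‖ := by
            rw [hu (k + 1), hu k]
            exact hT _ _
        _ ≤ q * (q ^ k * ‖D (u 0) - D (u 1)‖) := mul_le_mul_of_nonneg_left ih hq0
        _ = _ := by ring
  have hcauchy : CauchySeq u := by
    refine cauchySeq_of_le_geometric q (2 * ‖D (u 0) - D (u 1)‖) hq1 fun k => ?_
    rw [dist_eq_norm]
    have := (norm_le_D (u k - u (k + 1))).trans
      (mul_le_mul_of_nonneg_left (hk k) zero_le_two)
    linarith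
  obtain ⟨a, ha⟩ := cauchySeq_tendsto_of_complete hcauchy
  refine ⟨a, ?_⟩
  have h1 : Tendsto (fun k => ‖D (u k) - D a‖) atTop (𝓝 0) :=
    tendsto_iff_norm_sub_tendsto_zero.1 ((continuous_D.tendsto a).comp ha)
  have h2 : Tendsto (fun k => u (k + 1)) atTop (𝓝 (T a)) := by
    rw [tendsto_iff_norm_sub_tendsto_zero]
    refine squeeze_zero (fun _ => norm_nonneg _) (g := fun k => 2 * (q * ‖D (u k) - D a‖))
      (fun k => ?_) (by simpa using (h1.const_mul q).const_mul 2)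
    rw [hu]
    exact (norm_le_D _).trans (mul_le_mul_of_nonneg_left (hT _ _) zero_le_two)
  exact tendsto_nhds_unique h2 (ha.comp (tendsto_add_atTop_nat 1))

end ViscousG

end

/-! ### Assembly of the main theorem -/

theorem mainTheorem1 (n : ℕ) (hn : 0 < n) (d sL : ℝ) (hd : 0 < d) (hsL : 0 < sL)
    (V : ViscousG.Torus n → ViscousG.Vec n) (hV : MemLp V ∞ (ViscousG.torusMeasure n))
    (hV_mean : ∫ x, V x ∂ViscousG.torusMeasure n = 0) (hV_div : ViscousG.IsDivFree V)
    (P : ViscousG.Vec n) :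
    (∀ u : ViscousG.H1per n, ∃! v : ViscousG.H1per n, ViscousG.IsIterationStep d sL V P u v) ∧
    (Real.sqrt n / Real.pi < d →
      (∀ u : ℕ → ViscousG.H1per n,
        (∀ k, ViscousG.IsIterationStep d sL V P (u k) (u (k + 1))) →
        ∀ k, ‖ViscousG.D (u (k + 2)) - ViscousG.D (u (k + 1))‖ ≤
          Real.sqrt n / (Real.pi * d) * ‖ViscousG.D (u (k + 1)) - ViscousG.D (u k)‖) ∧
      ∃ (ubar : ViscousG.H1per n) (Hbar : ℝ),
        ViscousG.IsCorrector d sL V P ubar Hbar ∧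
        (∀ (w : ViscousG.H1per n) (H : ℝ),
          ViscousG.IsCorrector d sL V P w H → w = ubar ∧ H = Hbar) ∧
        Hbar = ViscousG.meanBurning sL P ubar ∧
        ∀ u : ℕ → ViscousG.H1per n,
          (∀ k, ViscousG.IsIterationStep d sL V P (u k) (u (k + 1))) →
          Tendsto u atTop (𝓝 ubar) ∧
          Tendsto (fun k => ViscousG.meanBurning sL P (u k)) atTop (𝓝 Hbar)) := by
  have hex := ViscousG.existsUnique_isIterationStep hd hsL hV hV_mean hV_div P
  refine ⟨hex, fun hdn => ?_⟩
  have hpi := Real.pi_pos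
  set q := Real.sqrt n / (Real.pi * d) with hq
  have hq0 : 0 ≤ q := by positivity
  have hq1 : q < 1 := by
    rw [hq, div_lt_one (by positivity)]
    rw [div_lt_iff₀ hpi] at hdn
    linarith
  -- The sharp Poincaré factor is below the stated one because `n ≥ 1`.
  have hqle : 1 / (2 * Real.pi * d) ≤ q := by
    have h1 : (1 : ℝ) ≤ Real.sqrt n := Real.one_le_sqrt.2 (by exact_mod_cast hn)
    refine div_le_div₀ (Real.sqrt_nonneg _) h1 (by positivity) ?_
    nlinarith [mul_pos hpi hd]
  have hstep {u₁ u₂ v₁ v₂ : ViscousG.H1per n} (h₁ : ViscousG.IsIterationStep d sL V P u₁ v₁)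
      (h₂ : ViscousG.IsIterationStep d sL V P u₂ v₂) :
      ‖ViscousG.D v₁ - ViscousG.D v₂‖ ≤ q * ‖ViscousG.D u₁ - ViscousG.D u₂‖ :=
    (ViscousG.norm_D_sub_le_of_isIterationStep hd hsL hV hV_mean hV_div h₁ h₂).trans
      (mul_le_mul_of_nonneg_right hqle (norm_nonneg _))
  refine ⟨fun u hu k => hstep (hu (k + 1)) (hu k), ?_⟩
  choose T hT _ using hex
  obtain ⟨a, ha⟩ := ViscousG.exists_fixedPoint_of_norm_D_sub_le hq0 hq1 (T := T)
    fun u v => hstep (hT u) (hT v)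
  have hfix : ViscousG.IsIterationStep d sL V P a a := by
    simpa only [ha] using hT a
  have hconv (u : ℕ → ViscousG.H1per n)
      (hu : ∀ k, ViscousG.IsIterationStep d sL V P (u k) (u (k + 1))) :
      Tendsto u atTop (𝓝 a) :=
    ViscousG.tendsto_of_norm_D_sub_le hq0 hq1 fun k => hstep (hu k) hfix
  refine ⟨a, ViscousG.meanBurning sL P a,
    (ViscousG.isCorrector_iff hV hV_mean hV_div P a _).2 ⟨rfl, hfix⟩, fun w H hw => ?_, rfl,
    fun u hu => ⟨hconv u hu,
      ((ViscousG.continuous_meanBurning sL P).tendsto a).comp (hconv u hu)⟩⟩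
  obtain ⟨rfl, hw⟩ := (ViscousG.isCorrector_iff hV hV_mean hV_div P w H).1 hw
  -- A corrector is a constant sequence of iterates, which must converge to `a`.
  obtain rfl := tendsto_nhds_unique tendsto_const_nhds (hconv (fun _ => w) fun _ => hw)
  exact ⟨rfl, rfl⟩
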